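/- **Conventions.** A Weil algebra is a commutative finite-dimensional $\mathbf{R}$-algebra $W$ of the form $W=\mathbf{R}\cdot 1\oplus I$, where $1\neq 0$ and $I$ is a nilpotent ideal. A cahiers algebra is an $\mathbf{R}$-algebra isomorphic to $\mathbf{R}[X_1,\dots,X_n]\otimes_{\mathbf{R}} W$ for some $n\ge 0$ and some Weil algebra $W$; cahiers algebras and all unital $\mathbf{R}$-algebra homomorphisms form a category $\widetilde{\mathfrak{W}}$. A topos is an elementary topos: a category with finite limits, exponentials and a subobject classifier. A Weil category is a pair $(\mathcal{K},\mathbf{D})$ of a topos $\mathcal{K}$ and a functor $\mathbf{D}:\widetilde{\mathfrak{W}}^{\mathrm{op}}\to\mathcal{K}$ (the Dubuc functor) that preserves finite products; in particular $\mathbf{D}(\mathbf{R})$ is a terminal object. **Theorem (Fundamental Theorem for Weil Categories).** Let $(\mathcal{K},\mathbf{D})$ be a Weil category and let $M$ be an object of $\mathcal{K}$. Then $(\mathcal{K}/M,\mathbf{D}_M)$ is a Weil category, where $\mathbf{D}_M:\widetilde{\mathfrak{W}}^{\mathrm{op}}\to\mathcal{K}/M$ is the functor that sends a cahiers algebra $A$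 to the canonical projection $\mathbf{D}(A)\times M\to M$ and a morphism $f:A\to B$ of cahiers algebras to $\mathbf{D}(f)\times\mathrm{id}_M:\mathbf{D}(B)\times M\to\mathbf{D}(A)\times M$. That is, $\mathcal{K}/M$ is a topos and $\mathbf{D}_M$ preserves finite products. -/

import Mathlib

open CategoryTheory CategoryTheory.Limits
open scoped TensorProduct

universe v u

/-- A Weil algebra (over the real numbers): a commutative, finite-dimensional real algebra `W`
that splits as `W = ℝ·1 ⊕ I` with `I` a nilpotent ideal. The splitting is given by an augmentation
`φ : W → ℝ`, an algebra homomorphism (hence the identity on `ℝ·1`), whose kernel is `I`. -/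
structure IsWeilAlgebra (W : Type) [CommRing W] [Algebra ℝ W] : Prop where
  finite : Module.Finite ℝ W
  exists_augmentation : ∃ φ : W →ₐ[ℝ] ℝ, IsNilpotent (RingHom.ker φ)

/-- A cahiers algebra: a commutative real algebra isomorphic to `ℝ[X₁, …, Xₙ] ⊗ W` for some
natural number `n` (possibly `0`) and some Weil algebra `W`. -/
def IsCahiersAlgebra (A : Type) [CommRing A] [Algebra ℝ A] : Prop :=
  ∃ (n : ℕ) (W : Type) (_ : CommRing W) (_ : Algebra ℝ W),
    IsWeilAlgebra W ∧ Nonempty (A ≃ₐ[ℝ] (MvPolynomial (Fin n) ℝ ⊗[ℝ] W))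

/-- The category of cahiers algebras and all (unital) homomorphisms of real algebras, as a full
subcategory of the category of commutative real algebras. -/
abbrev CahiersAlg : Type 1 :=
  ObjectProperty.FullSubcategory (fun A : CommAlgCat.{0} ℝ => IsCahiersAlgebra A)

/-- An (elementary) topos: a category with finite limits, with exponentials (every functor
`X × -` has a right adjoint), and with a subobject classifier. -/
class IsElementaryTopos (K : Type u) [Category.{v} K] : Prop where
  hasFiniteLimits : HasFiniteLimits K
  isLeftAdjoint_prod : ∀ X : K, (prod.functor.obj X).IsLeftAdjoint
  hasSubobjectClassifier : HasSubobjectClassifier K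

attribute [instance] IsElementaryTopos.hasFiniteLimits

/-- `(K, D)` is a Weil category: `K` is a topos and `D : CahiersAlgᵒᵖ ⥤ K` (the Dubuc functor)
preserves finite products. Finite products in `CahiersAlgᵒᵖ` are finite coproducts of cahiers
algebras; the empty case says that `D` sends the initial algebra `ℝ` to a terminal object. -/
structure IsWeilCategory (K : Type u) [Category.{v} K] (D : CahiersAlgᵒᵖ ⥤ K) : Prop where
  isElementaryTopos : IsElementaryTopos K
  preservesFiniteProducts : PreservesFiniteProducts D

/-- The functor `D_M` to the slice over `M`: it sends a cahiers algebra `A` to the projection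
`D(A) × M ⟶ M`, and a morphism `f` to `D(f) × M`. -/
noncomputable def sliceDubuc {K : Type u} [Category.{v} K] [HasBinaryProducts K]
    (D : CahiersAlgᵒᵖ ⥤ K) (M : K) : CahiersAlgᵒᵖ ⥤ Over M where
  obj A := Over.mk (prod.snd : D.obj A ⨯ M ⟶ M)
  map f := Over.homMk (prod.map (D.map f) (𝟙 M)) (by simp)
  map_id A := by ext; simp
  map_comp f g := by ext; simp

-- Finite limits in the slice are inherited, its classifier is `Ω × M → M`, and `D_M` is `D`
-- followed by the right adjoint `M^*`. The work lies in the exponentials. The right adjoint of `Y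
-- ×_M -` need only be found on objects `M^*(Ω^V)`: every object of the slice embeds in one
-- (`Over.exists_mono_star`) and monos are regular, so it is an equalizer of a pair of maps between
-- two of them. On `M^*(Ω^V)` one must represent `Z ↦ Hom(V × (Y ×_M Z), Ω)`. Since `Y ×_M Z` embeds
-- in `Y × Z` by a cartesian mono, direct image and restriction make this a retract of `Z ↦ Hom(V ×
-- (Y × Z), Ω)`, which is representable because the functors composed are left adjoints. Splitting
-- an idempotent represents the retract (`Functor.IsRepresentable.of_retract`).

attribute [local simp] prod.lift_fst prod.lift_snd prod.lift_fst_assoc prod.lift_snd_assoc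
  pullback.lift_fst pullback.lift_snd

namespace CategoryTheory

/-! ### Representable presheaves and partially defined right adjoints -/

section Representability

variable {C : Type*} [Category.{v} C]

/-- Over a category with equalizers, a retract of a representable presheaf is representable. -/
theorem Functor.IsRepresentable.of_retract [HasEqualizers C] {P Q : Cᵒᵖ ⥤ Type v}
    (hQ : Q.IsRepresentable) (s : P ⟶ Q) (r : Q ⟶ P) (hsr : s ≫ r = 𝟙 P) :
    P.IsRepresentable := by
  let a : yoneda.obj Q.reprX ≅ Q := Q.representableBy.toIso
  -- By Yoneda the idempotent `r ≫ s` comes from an idempotent `e` of the representing object; the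
  -- equalizer of `𝟙` and `e` splits it.
  obtain ⟨e, he⟩ := yoneda.map_surjective (a.hom ≫ r ≫ s ≫ a.inv)
  have hee : e ≫ e = e := by
    apply yoneda.map_injective
    simp [he, reassoc_of% hsr]
  have hee' : e ≫ 𝟙 _ = e ≫ e := by simp [hee]
  have hι : equalizer.ι (𝟙 _) e ≫ e = equalizer.ι (𝟙 _) e := by
    simpa using (equalizer.condition (𝟙 _) e).symm
  have hp : equalizer.ι (𝟙 _) e ≫ equalizer.lift e hee' = 𝟙 _ := by
    ext
    simp [hι]
  let b : yoneda.obj (equalizer (𝟙 _) e) ≅ P :=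
    { hom := yoneda.map (equalizer.ι _ _) ≫ a.hom ≫ r
      inv := s ≫ a.inv ≫ yoneda.map (equalizer.lift e hee')
      hom_inv_id := by
        have : yoneda.map (equalizer.ι (𝟙 _) e) ≫ (a.hom ≫ r ≫ s ≫ a.inv) ≫
            yoneda.map (equalizer.lift e hee') = 𝟙 _ := by
          rw [← he, ← Functor.map_comp, ← Functor.map_comp, reassoc_of% hι, hp, Functor.map_id]
        simpa using this
      inv_hom_id := by
        have h1 : yoneda.map (equalizer.lift e hee') ≫ yoneda.map (equalizer.ι (𝟙 _) e) =
            a.hom ≫ r ≫ s ≫ a.inv := by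
          rw [← Functor.map_comp, equalizer.lift_ι, he]
        simp [reassoc_of% h1, hsr] }
  exact (Functor.representableByEquiv.symm b).isRepresentable

/-- If the right adjoint of `F ⋙ H` is defined at `Y` and `H ⊣ R`, then the right adjoint of `F`
is defined at `R.obj Y`. -/
theorem Functor.rightAdjointObjIsDefined_obj_of_comp {D E : Type*} [Category.{v} D]
    [Category.{v} E] {F : C ⥤ D} {H : D ⥤ E} {R : E ⥤ D} (adj : H ⊣ R) {Y : E}
    (h : (F ⋙ H).rightAdjointObjIsDefined Y) :
    F.rightAdjointObjIsDefined (R.obj Y) := by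
  rw [Functor.rightAdjointObjIsDefined_iff] at h ⊢
  let a : (F ⋙ H).op ⋙ yoneda.obj Y ≅ F.op ⋙ yoneda.obj (R.obj Y) :=
    NatIso.ofComponents (fun Z => (adj.homEquiv (F.obj Z.unop) Y).toIso) (by
      intro Z Z' f
      ext g
      exact adj.homEquiv_naturality_left _ _)
  exact ((Functor.representableBy _).ofIso a).isRepresentable

end Representability

/-! ### Direct images of subobjects and the classifier of a slice -/

section Classifier

variable {K : Type u} [Category.{v} K] [HasFiniteLimits K]

namespace Subobject.Classifier

variable (c : Subobject.Classifier K) {X Y : K} (i : X ⟶ Y) [Mono i]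

/-- Direct image of (classified) subobjects along a monomorphism. -/
noncomputable def directImage (φ : X ⟶ c.Ω) : Y ⟶ c.Ω :=
  c.χ (pullback.fst φ c.truth ≫ i)

theorem isPullback_fst (φ : X ⟶ c.Ω) :
    IsPullback (pullback.fst φ c.truth) (c.χ₀ _) φ c.truth := by
  rw [c.isTerminalΩ₀.hom_ext (c.χ₀ _) (pullback.snd φ c.truth)]
  exact IsPullback.of_hasPullback φ c.truth

theorem comp_directImage (φ : X ⟶ c.Ω) : i ≫ c.directImage i φ = φ := by
  have h : IsPullback (pullback.fst φ c.truth) (𝟙 _) i (pullback.fst φ c.truth ≫ i) := by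
    refine ⟨⟨by simp⟩, ⟨PullbackCone.IsLimit.mk _ (fun s => s.snd) (fun s => ?_) (by simp) ?_⟩⟩
    · rw [← cancel_mono i]
      simp [s.condition]
    · intro s m _ h
      simpa using h
  refine Eq.trans ?_ (c.uniq _ (c.isPullback_fst φ)).symm
  exact c.uniq (pullback.fst φ c.truth) (h.paste_vert (c.isPullback (pullback.fst φ c.truth ≫ i)))

/-- Beck–Chevalley for monos: the pasted pullbacks show that both sides classify the same subobject
of `Y'`. -/
theorem directImage_naturality {X' Y' : K} (i' : X' ⟶ Y') [Mono i'] {f : X' ⟶ X} {g : Y' ⟶ Y}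
    (h : IsPullback f i' i g) (φ : X ⟶ c.Ω) :
    g ≫ c.directImage i φ = c.directImage i' (f ≫ φ) := by
  have h1 : IsPullback (pullback.fst (f ≫ φ) c.truth)
      (pullback.lift (pullback.fst (f ≫ φ) c.truth ≫ f) (pullback.snd _ _)
        (by rw [Category.assoc, pullback.condition])) f (pullback.fst φ c.truth) := by
    refine IsPullback.of_bot ?_ (by simp) (IsPullback.of_hasPullback φ c.truth)
    simpa using IsPullback.of_hasPullback (f ≫ φ) c.truth
  exact c.uniq _ ((h1.paste_horiz h.flip).paste_vert (c.isPullback _))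

/-- If `F` embeds by a cartesian monomorphism into a left adjoint, then the right adjoint of `F`
is defined at the subobject classifier. -/
theorem rightAdjointObjIsDefined {C : Type*} [Category.{v} C] [HasEqualizers C] {F F' : C ⥤ K}
    [F'.IsLeftAdjoint] (j : F ⟶ F') [∀ Z, Mono (j.app Z)] (hj : NatTrans.Equifibered j) :
    F.rightAdjointObjIsDefined c.Ω := by
  have hF' := Functor.rightAdjointObjIsDefined_of_adjunction (Adjunction.ofIsLeftAdjoint F') c.Ω
  rw [Functor.rightAdjointObjIsDefined_iff] at hF' ⊢
  refine hF'.of_retract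
    { app Z := ↾fun φ => c.directImage (j.app Z.unop) φ
      naturality Z Z' f := ?_ }
    { app Z := ↾fun φ => j.app Z.unop ≫ φ
      naturality Z Z' f := ?_ } ?_
  · ext φ
    exact (c.directImage_naturality _ _ (hj f.unop) φ).symm
  · ext φ
    simp
  · ext Z φ
    exact c.comp_directImage _ φ

end Subobject.Classifier

variable (M : K)

/-- The slice of a category with a subobject classifier has a subobject classifier. -/
instance Over.hasSubobjectClassifier [HasSubobjectClassifier K] :
    HasSubobjectClassifier (Over M) := by
  let c : Subobject.Classifier K := HasSubobjectClassifier.exists_classifier.some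
  have hc : IsPullback (prod.lift (c.χ₀ M ≫ c.truth) (𝟙 M)) (c.χ₀ M) (prod.fst : c.Ω ⨯ M ⟶ c.Ω)
      c.truth := by
    refine ⟨⟨by simp⟩, ⟨PullbackCone.IsLimit.mk _ (fun s => s.fst ≫ prod.snd) (fun s => ?_)
      (fun s => c.isTerminalΩ₀.hom_ext _ _) (fun s m h _ => ?_)⟩⟩
    · ext
      · rw [Category.assoc, prod.lift_fst, s.condition, ← Category.assoc]
        congr 1
        exact c.isTerminalΩ₀.hom_ext _ _
      · simp
    · simp [← h]
  refine ⟨⟨Subobject.Classifier.mkOfTerminalΩ₀ (Over.mk (𝟙 M)) Over.mkIdTerminal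
    (Over.mk (prod.snd : c.Ω ⨯ M ⟶ M)) (Over.homMk (prod.lift (c.χ₀ M ≫ c.truth) (𝟙 M)))
    (fun {U X} m _ => Over.homMk (prod.lift (c.χ m.left) X.hom)) (fun {U X} m _ => ?_)
    (fun {U X} m _ χ' h => ?_)⟩⟩
  · have hm : IsPullback m.left U.hom (prod.lift (c.χ m.left) X.hom)
        (prod.lift (c.χ₀ M ≫ c.truth) (𝟙 M)) := by
      have h₁ : U.hom ≫ c.χ₀ M = c.χ₀ U.left := c.isTerminalΩ₀.hom_ext _ _
      refine IsPullback.of_bot (h₃₁ := c.truth) (v₂₁ := c.χ₀ M) (v₂₂ := prod.fst) ?_ ?_ hc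
      · rw [h₁, prod.lift_fst]
        exact c.isPullback m.left
      · apply prod.hom_ext
        · simp [-prod.comp_lift, (c.isPullback m.left).w, reassoc_of% h₁]
        · simp [-prod.comp_lift]
    have h₀ : U.hom = (Over.mkIdTerminal.from U).left := by simp
    rw [h₀] at hm
    exact IsPullback.of_map (Over.forget M) (by ext1; exact hm.w) hm
  · have h' := (h.map (Over.forget M)).paste_vert hc
    ext1
    apply prod.hom_ext
    · simpa using c.uniq m.left h'
    · simpa using Over.w χ'

end Classifier

/-! ### Exponentials in a slice -/

section Exponentials

variable {K : Type u} [Category.{v} K] [HasFiniteLimits K] {M : K}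

/-- The comparison `Y ×_M Z ⟶ Y × Z`. -/
noncomputable def Over.prodLeft (Y Z : Over M) : (Y ⨯ Z).left ⟶ Y.left ⨯ Z.left :=
  prod.lift (prod.fst : Y ⨯ Z ⟶ Y).left (prod.snd : Y ⨯ Z ⟶ Z).left

@[simp]
theorem Over.prodLeft_fst (Y Z : Over M) :
    Over.prodLeft Y Z ≫ prod.fst = (prod.fst : Y ⨯ Z ⟶ Y).left :=
  prod.lift_fst _ _

@[simp]
theorem Over.prodLeft_snd (Y Z : Over M) :
    Over.prodLeft Y Z ≫ prod.snd = (prod.snd : Y ⨯ Z ⟶ Z).left :=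
  prod.lift_snd _ _

theorem Over.prodLeft_naturality (Y : Over M) {Z' Z : Over M} (f : Z' ⟶ Z) :
    (prod.map (𝟙 Y) f).left ≫ Over.prodLeft Y Z =
      Over.prodLeft Y Z' ≫ prod.map (𝟙 Y.left) f.left := by
  apply prod.hom_ext
  · rw [Category.assoc, Over.prodLeft_fst, Category.assoc, prod.map_fst, Category.comp_id,
      Over.prodLeft_fst, ← Over.comp_left, prod.map_fst, Category.comp_id]
  · rw [Category.assoc, Over.prodLeft_snd, Category.assoc, prod.map_snd,
      ← Category.assoc, Over.prodLeft_snd, ← Over.comp_left, prod.map_snd, Over.comp_left]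

theorem Over.prod_left_hom_ext {Y Z : Over M} {S : K} {u v : S ⟶ (Y ⨯ Z).left}
    (h₁ : u ≫ (prod.fst : Y ⨯ Z ⟶ Y).left = v ≫ (prod.fst : Y ⨯ Z ⟶ Y).left)
    (h₂ : u ≫ (prod.snd : Y ⨯ Z ⟶ Z).left = v ≫ (prod.snd : Y ⨯ Z ⟶ Z).left) : u = v := by
  have hv : v ≫ (Y ⨯ Z).hom = u ≫ (Y ⨯ Z).hom := by
    rw [← Over.w (prod.fst : Y ⨯ Z ⟶ Y), reassoc_of% h₁]
  have : (Over.homMk u : Over.mk (u ≫ (Y ⨯ Z).hom) ⟶ Y ⨯ Z) = Over.homMk v hv := by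
    ext1
    · ext1
      simpa using h₁
    · ext1
      simpa using h₂
  exact congrArg CommaMorphism.left this

instance Over.mono_prodLeft (Y Z : Over M) : Mono (Over.prodLeft Y Z) where
  right_cancellation u v h := by
    apply Over.prod_left_hom_ext
    · simpa using h =≫ prod.fst
    · simpa using h =≫ prod.snd

theorem Over.exists_lift_prodLeft (Y : Over M) {Z' Z : Over M} (f : Z' ⟶ Z) {S : K}
    (u : S ⟶ (Y ⨯ Z).left) (w : S ⟶ Y.left ⨯ Z'.left)
    (h : u ≫ Over.prodLeft Y Z = w ≫ prod.map (𝟙 _) f.left) :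
    ∃ l : S ⟶ (Y ⨯ Z').left, l ≫ Over.prodLeft Y Z' = w := by
  have h₁ : u ≫ (prod.fst : Y ⨯ Z ⟶ Y).left = w ≫ prod.fst := by simpa using h =≫ prod.fst
  have h₂ : u ≫ (prod.snd : Y ⨯ Z ⟶ Z).left = w ≫ prod.snd ≫ f.left := by
    simpa using h =≫ prod.snd
  have hZ : (w ≫ prod.snd) ≫ Z'.hom = u ≫ (Y ⨯ Z).hom := by
    rw [← Over.w f, ← Over.w (prod.snd : Y ⨯ Z ⟶ Z), reassoc_of% h₂]
    simp
  have hY : (w ≫ prod.fst) ≫ Y.hom = u ≫ (Y ⨯ Z).hom := by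
    rw [← Over.w (prod.fst : Y ⨯ Z ⟶ Y), ← h₁, Category.assoc]
  let y : Over.mk (u ≫ (Y ⨯ Z).hom) ⟶ Y := Over.homMk (w ≫ prod.fst) hY
  let z : Over.mk (u ≫ (Y ⨯ Z).hom) ⟶ Z' := Over.homMk (w ≫ prod.snd) hZ
  refine ⟨(prod.lift y z).left, ?_⟩
  apply prod.hom_ext
  · rw [Category.assoc, Over.prodLeft_fst, ← Over.comp_left, prod.lift_fst]
    rfl
  · rw [Category.assoc, Over.prodLeft_snd, ← Over.comp_left, prod.lift_snd]
    rfl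

/-- `Y ×_M Z` is cut out of `Y × Z` by agreement over `M`, and `f` respects the maps to `M`. -/
theorem Over.isPullback_prodLeft (Y : Over M) {Z' Z : Over M} (f : Z' ⟶ Z) :
    IsPullback (prod.map (𝟙 Y) f).left (Over.prodLeft Y Z') (Over.prodLeft Y Z)
      (prod.map (𝟙 Y.left) f.left) := by
  choose l hl using fun s : PullbackCone (Over.prodLeft Y Z) (prod.map (𝟙 Y.left) f.left) =>
    Over.exists_lift_prodLeft Y f s.fst s.snd s.condition
  refine ⟨⟨Over.prodLeft_naturality Y f⟩, ⟨PullbackCone.IsLimit.mk _ l (fun s => ?_) hl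
    (fun s m _ h => ?_)⟩⟩
  · rw [← cancel_mono (Over.prodLeft Y Z), Category.assoc, Over.prodLeft_naturality,
      s.condition, reassoc_of% hl s]
  · rw [← cancel_mono (Over.prodLeft Y Z'), h, hl]

/-- The comparison `Y ×_M Z ⟶ Y × Z`, as a natural transformation in `Z`. -/
noncomputable def Over.forgetProdComparison (Y : Over M) :
    prod.functor.obj Y ⋙ Over.forget M ⟶ Over.forget M ⋙ prod.functor.obj Y.left where
  app Z := Over.prodLeft Y Z
  naturality _ _ f := Over.prodLeft_naturality Y f

instance Over.mono_forgetProdComparison_app (Y Z : Over M) :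
    Mono ((Over.forgetProdComparison Y).app Z) :=
  Over.mono_prodLeft Y Z

theorem Over.equifibered_forgetProdComparison (Y : Over M) :
    NatTrans.Equifibered (Over.forgetProdComparison Y) :=
  fun _ _ f => Over.isPullback_prodLeft Y f

/-- Keeps the comparison cartesian after applying `V × -`; a cospan is connected. -/
instance prod.preservesLimitsOfShape_walkingCospan (V : K) :
    PreservesLimitsOfShape WalkingCospan (prod.functor.obj V) := by
  let e := ULiftHomULiftCategory.equiv.{v, v} WalkingCospan
  have : IsConnected (ULiftHom.{v} (ULift.{v} WalkingCospan)) := isConnected_of_equivalent e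
  have := prod_preservesConnectedLimits (J := ULiftHom.{v} (ULift.{v} WalkingCospan)) V
  exact preservesLimitsOfShape_of_equiv e.symm _

variable [∀ X : K, (prod.functor.obj X).IsLeftAdjoint]

/-- The singleton map `W → Ω^W`, transpose of the classifier of the diagonal. -/
theorem exists_mono_rightAdjoint_obj (c : Subobject.Classifier K) (W : K) :
    ∃ s : W ⟶ (prod.functor.obj W).rightAdjoint.obj c.Ω, Mono s := by
  have : Mono (diag W) := inferInstanceAs (Mono (prod.lift (𝟙 W) (𝟙 W)))
  let adj := Adjunction.ofIsLeftAdjoint (prod.functor.obj W)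
  let χ : W ⨯ W ⟶ c.Ω := c.χ (diag W)
  refine ⟨adj.homEquiv W c.Ω χ, ⟨fun {S} u v h => ?_⟩⟩
  have h' : prod.map (𝟙 W) u ≫ χ = prod.map (𝟙 W) v ≫ χ :=
    (adj.homEquiv S c.Ω).injective ((adj.homEquiv_naturality_left u χ).trans
      (h.trans (adj.homEquiv_naturality_left v χ).symm))
  -- If `{u} = {v}`, then `u ∈ {u}` gives `(u, v)` in the diagonal.
  have h₁ : prod.lift u u ≫ χ = prod.lift u v ≫ χ := by
    simpa using prod.lift u (𝟙 S) ≫= h'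
  have h₂ : prod.lift u v ≫ χ = c.χ₀ S ≫ c.truth := by
    rw [← h₁, show prod.lift u u = u ≫ diag W by simp, Category.assoc, (c.isPullback (diag W)).w,
      ← Category.assoc]
    congr 1
    exact c.isTerminalΩ₀.hom_ext _ _
  have h₃ := (c.isPullback (diag W)).lift_fst _ _ h₂
  have hu := h₃ =≫ prod.fst
  have hv := h₃ =≫ prod.snd
  simp only [Category.assoc, prod.lift_fst, prod.lift_snd] at hu hv
  exact hu.symm.trans hv

theorem Over.exists_mono_star (c : Subobject.Classifier K) (W : Over M) :
    ∃ (V : K) (s : W ⟶ (Over.star M).obj ((prod.functor.obj V).rightAdjoint.obj c.Ω)), Mono s := by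
  obtain ⟨s, hs⟩ := exists_mono_rightAdjoint_obj c W.left
  have := Functor.preservesMonomorphisms_of_adjunction (Over.forgetAdjStar M)
  have h₁ : Mono ((Over.forgetAdjStar M).unit.app W) :=
    (Over.forgetAdjStar M).unit_mono_of_L_faithful W
  have h₂ : Mono ((Over.star M).map s) := (Over.star M).map_mono s
  exact ⟨W.left, (Over.forgetAdjStar M).unit.app W ≫ (Over.star M).map s, mono_comp' h₁ h₂⟩

theorem Over.rightAdjointObjIsDefined_prod_star (c : Subobject.Classifier K) (Y : Over M) (V : K) :
    (prod.functor.obj Y).rightAdjointObjIsDefined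
      ((Over.star M).obj ((prod.functor.obj V).rightAdjoint.obj c.Ω)) := by
  refine Functor.rightAdjointObjIsDefined_obj_of_comp
    ((Over.forgetAdjStar M).comp (Adjunction.ofIsLeftAdjoint (prod.functor.obj V))) ?_
  have (Z : Over M) :
      Mono ((Functor.whiskerRight (Over.forgetProdComparison Y) (prod.functor.obj V)).app Z) :=
    inferInstanceAs (Mono ((prod.functor.obj V).map ((Over.forgetProdComparison Y).app Z)))
  exact c.rightAdjointObjIsDefined
    (Functor.whiskerRight (Over.forgetProdComparison Y) (prod.functor.obj V))
    ((Over.equifibered_forgetProdComparison Y).whiskerRight _)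

/-- Slices of a topos have exponentials. -/
theorem Over.isLeftAdjoint_prod [HasSubobjectClassifier K] (Y : Over M) :
    (prod.functor.obj Y).IsLeftAdjoint := by
  apply Functor.isLeftAdjoint_of_rightAdjointObjIsDefined_eq_top
  ext W
  simp only [Pi.top_apply, Prop.top_eq_true, iff_true]
  let c : Subobject.Classifier K := HasSubobjectClassifier.exists_classifier.some
  obtain ⟨V, s, hs⟩ := Over.exists_mono_star c W
  let r := regularMonoOfMono s
  -- Composing the parallel pair with a mono `t` keeps the equalizer and moves its target to the
  -- form `M^*(Ω^V')`.
  obtain ⟨V', t, ht⟩ := Over.exists_mono_star c r.Z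
  refine Functor.rightAdjointObjIsDefined_of_isLimit (isEqualizerCompMono r.isLimit t) ?_
  rintro (_ | _)
  · exact Over.rightAdjointObjIsDefined_prod_star c Y V
  · exact Over.rightAdjointObjIsDefined_prod_star c Y V'

end Exponentials

end CategoryTheory

/-- The slice `K / M` of a topos is a topos. -/
theorem IsElementaryTopos.over {K : Type u} [Category.{v} K] [IsElementaryTopos K] (M : K) :
    IsElementaryTopos (Over M) :=
  have := IsElementaryTopos.isLeftAdjoint_prod (K := K)
  have := IsElementaryTopos.hasSubobjectClassifier (K := K)
  { hasFiniteLimits := inferInstance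
    isLeftAdjoint_prod := Over.isLeftAdjoint_prod
    hasSubobjectClassifier := inferInstance }

/-- `D_M` is the composite of `D` with the functor `M^* : K ⥤ Over M`. -/
noncomputable def sliceDubucIso {K : Type u} [Category.{v} K] [HasBinaryProducts K]
    (D : CahiersAlgᵒᵖ ⥤ K) (M : K) : sliceDubuc D M ≅ D ⋙ Over.star M :=
  NatIso.ofComponents
    -- `Over.star` has `M` as the first factor, hence the swap.
    (fun A => Over.isoMk (prod.braiding (D.obj A) M)
      ((congrArg _ (prod.lift_fst _ _)).trans (prod.lift_fst _ _)))
    (fun f => by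
      ext1
      exact braid_natural _ _)

theorem theorem4p1 {K : Type u} [Category.{v} K] (D : CahiersAlgᵒᵖ ⥤ K)
    (hD : IsWeilCategory K D) (M : K) :
    haveI : IsElementaryTopos K := hD.isElementaryTopos
    IsWeilCategory (Over M) (sliceDubuc D M) := by
  have := hD.isElementaryTopos
  have := hD.preservesFiniteProducts
  have : PreservesLimitsOfSize.{0, 0} (Over.star M) :=
    (Over.forgetAdjStar M).rightAdjoint_preservesLimits
  exact ⟨IsElementaryTopos.over M,
    ⟨fun n => preservesLimitsOfShape_of_natIso (sliceDubucIso D M).symm⟩⟩
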